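/- Let $I=[0,1]$ with Lebesgue measure $\mu$. A \emph{graphon} is a symmetric bounded Lebesgue measurable function $W:I^2\to\mathbb R$. Let $\Phi_0$ be the set of bijections $\phi:I\to I$ such that $\phi$ and $\phi^{-1}$ are both Lebesgue measurable and measure preserving, and put $W^\phi(x,y)=W(\phi(x),\phi(y))$. For graphons $U,W$ let $$\delta_\Box(U,W)=\inf_{\phi\in\Phi_0}\ \sup_{S,T\subseteq I\text{ measurable}}\Big|\int_{S\times T}(U-W^\phi)\,d\mu\Big|,\qquad \delta_1(U,W)=\inf_{\phi\in\Phi_0}\int_{I^2}|U-W^\phi|\,d\mu .$$ Let $[W]$ be the class of all graphons $U$ with $\delta_\Box(U,W)=0$; such a class is a \emph{graph limit} if it contains a graphon with values in $[0,1]$. A finite simple graph $G$ on vertices $x_1,\dots,x_n$ is identified with the graph limit $[W_G]$, where $W_G(x,y)=1$ if $(x,y)\in[\frac{k-1}n,\frac kn)\times[\frac{l-1}n,\frac ln)$ for some adjacent $x_k,x_l$, and $W_G(x,y)=0$ otherwise. Distances between classes are the distances between their representatives. Let $G_1,G_2,\dots$ be a sequence of finite simple graphs that converges in the distance $\delta_\Box$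 to a graph limit $[W]$, where $W$ is any representative of it. Then $(G_n)$ converges to $[W]$ in the distance $\delta_1$ if and only if $W(x,y)\in\{0,1\}$ for almost every $(x,y)\in I^2$. Here convergence in $\delta_1$ means that $\delta_1(U_n,W)\to0$, and the equivalence holds for any choice of representatives $U_n\in[W_{G_n}]$ (in particular for $U_n=W_{G_n}$). -/

import Mathlib

open MeasureTheory Filter Topology

noncomputable section

/-! ### Graphons

Lebesgue measurable sets and functions on `[0,1]` and on `[0,1]²` are the null measurable sets and
functions of the Borel-Lebesgue measure, that is, those measurable for its completion. -/

/-- A graphon: a symmetric bounded Lebesgue measurable function `[0,1]² → ℝ`. -/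
structure Graphon where
  toFun : unitInterval × unitInterval → ℝ
  symm' : ∀ x y, toFun (x, y) = toFun (y, x)
  bounded' : ∃ C : ℝ, ∀ p, |toFun p| ≤ C
  measurable' : NullMeasurable toFun volume

namespace Graphon

instance : CoeFun Graphon (fun _ => unitInterval × unitInterval → ℝ) := ⟨toFun⟩

/-- The graphon takes all its values in `[0,1]`. -/
def IsUnitValued (W : Graphon) : Prop := ∀ p, 0 ≤ W p ∧ W p ≤ 1

end Graphon

/-! ### Measure preserving maps -/

/-- A measure preserving function `([0,1], Lebesgue) → ([0,1], Lebesgue)`. -/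
def IsLebesguePreserving (φ : unitInterval → unitInterval) : Prop :=
  ∀ A : Set unitInterval, NullMeasurableSet A volume →
    NullMeasurableSet (φ ⁻¹' A) volume ∧ volume (φ ⁻¹' A) = volume A

/-- The bijections `φ` of `[0,1]` such that both `φ` and its inverse are measure preserving. -/
abbrev LebesgueAut : Type :=
  {φ : Equiv.Perm unitInterval // IsLebesguePreserving φ ∧ IsLebesguePreserving φ.symm}

/-- The function `W^φ`, that is, `(x, y) ↦ W (φ x, φ y)`. -/
def relabel (f : unitInterval × unitInterval → ℝ) (φ : unitInterval → unitInterval) :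
    unitInterval × unitInterval → ℝ := fun p => f (φ p.1, φ p.2)

/-! ### Norms and distances of graphons -/

/-- The cut norm: the supremum of `|∫_{S × T} f|` over Lebesgue measurable `S, T ⊆ [0,1]`. -/
def cutNorm (f : unitInterval × unitInterval → ℝ) : ℝ :=
  sSup {r : ℝ | ∃ S T : Set unitInterval, NullMeasurableSet S volume ∧ NullMeasurableSet T volume ∧
    r = |∫ p in S ×ˢ T, f p|}

/-- The `ℓ₁`-norm. -/
def ellOneNorm (f : unitInterval × unitInterval → ℝ) : ℝ := ∫ p, |f p|

namespace Graphon

/-- The cut distance `δ_□(U, W)`, the infimum of `‖U - W^φ‖_□`. -/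
def cutDist (U W : Graphon) : ℝ := ⨅ φ : LebesgueAut, cutNorm (fun p => U p - relabel W φ.1 p)

/-- The distance `δ₁(U, W)`, the infimum of `‖U - W^φ‖₁`. -/
def delta1 (U W : Graphon) : ℝ := ⨅ φ : LebesgueAut, ellOneNorm (fun p => U p - relabel W φ.1 p)

end Graphon

/-! ### The cut distance is a pseudometric -/

namespace LebesgueAut

def one : LebesgueAut := ⟨Equiv.refl _, fun _ hA => ⟨hA, rfl⟩, fun _ hA => ⟨hA, rfl⟩⟩

def inv (φ : LebesgueAut) : LebesgueAut := ⟨φ.1.symm, φ.2.2, φ.2.1⟩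

def comp (φ ψ : LebesgueAut) : LebesgueAut :=
  ⟨ψ.1.trans φ.1,
    fun A hA => ⟨(ψ.2.1 _ (φ.2.1 A hA).1).1, (ψ.2.1 _ (φ.2.1 A hA).1).2.trans (φ.2.1 A hA).2⟩,
    fun A hA => ⟨(φ.2.2 _ (ψ.2.2 A hA).1).1, (φ.2.2 _ (ψ.2.2 A hA).1).2.trans (ψ.2.2 A hA).2⟩⟩

instance : Nonempty LebesgueAut := ⟨one⟩

end LebesgueAut

theorem IsLebesguePreserving.aemeasurable {φ : unitInterval → unitInterval}
    (h : IsLebesguePreserving φ) : AEMeasurable φ volume := by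
  have : NullMeasurable φ volume := fun s hs => (h s hs.nullMeasurableSet).1
  exact this.aemeasurable

theorem IsLebesguePreserving.map_eq {φ : unitInterval → unitInterval}
    (h : IsLebesguePreserving φ) : Measure.map φ volume = volume := by
  ext s hs
  rw [Measure.map_apply_of_aemeasurable h.aemeasurable hs, (h s hs.nullMeasurableSet).2]

theorem IsLebesguePreserving.prod {φ : unitInterval → unitInterval}
    (h : IsLebesguePreserving φ) :
    AEMeasurable (fun p : unitInterval × unitInterval => (φ p.1, φ p.2)) volume ∧
      Measure.map (fun p : unitInterval × unitInterval => (φ p.1, φ p.2)) volume = volume := by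
  obtain ⟨g, hg, hφg⟩ := h.aemeasurable
  have hgm : MeasurePreserving g volume volume :=
    ⟨hg, by rw [← Measure.map_congr hφg, h.map_eq]⟩
  have hp := hgm.prod hgm
  have h1 : ∀ᵐ p : unitInterval × unitInterval, φ p.1 = g p.1 :=
    Measure.quasiMeasurePreserving_fst.ae hφg
  have h2 : ∀ᵐ p : unitInterval × unitInterval, φ p.2 = g p.2 :=
    Measure.quasiMeasurePreserving_snd.ae hφg
  have h3 : (fun p : unitInterval × unitInterval => (φ p.1, φ p.2)) =ᵐ[volume] Prod.map g g := by
    filter_upwards [h1, h2] with p hp1 hp2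
    simp [hp1, hp2, Prod.map]
  refine ⟨⟨_, hp.measurable, h3⟩, ?_⟩
  rw [Measure.map_congr h3]
  exact hp.map_eq

theorem Integrable.relabel' {f : unitInterval × unitInterval → ℝ} (hf : Integrable f volume)
    (φ : LebesgueAut) : Integrable (relabel f φ.1) volume := by
  obtain ⟨h1, h2⟩ := φ.2.1.prod
  have := (integrable_map_measure (f := fun p : unitInterval × unitInterval => (φ.1 p.1, φ.1 p.2))
    (g := f) (μ := volume) (by rw [h2]; exact hf.1) h1).1 (by rw [h2]; exact hf)
  exact this

theorem Graphon.integrable (W : Graphon) : Integrable W volume := by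
  obtain ⟨C, hC⟩ := W.bounded'
  exact Integrable.of_bound W.measurable'.aemeasurable.aestronglyMeasurable C
    (Eventually.of_forall fun p => by simpa using hC p)

theorem nullMeasurableSet_rect {S T : Set unitInterval} (hS : NullMeasurableSet S volume)
    (hT : NullMeasurableSet T volume) :
    NullMeasurableSet (S ×ˢ T) (volume : Measure (unitInterval × unitInterval)) := by
  exact hS.prod hT

theorem setIntegral_relabel {f : unitInterval × unitInterval → ℝ} (hf : Integrable f volume)
    (φ : LebesgueAut) {S T : Set unitInterval} (hS : NullMeasurableSet S volume)
    (hT : NullMeasurableSet T volume) :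
    ∫ p in S ×ˢ T, f p = ∫ p in (φ.1 ⁻¹' S) ×ˢ (φ.1 ⁻¹' T), relabel f φ.1 p := by
  obtain ⟨h1, h2⟩ := φ.2.1.prod
  have hR := nullMeasurableSet_rect hS hT
  have hR' := nullMeasurableSet_rect (φ.2.1 S hS).1 (φ.2.1 T hT).1
  rw [← integral_indicator₀ hR, ← integral_indicator₀ hR']
  have := integral_map (μ := volume) h1 (f := (S ×ˢ T).indicator f)
    (by rw [h2]; exact hf.1.indicator₀ hR)
  rw [h2] at this
  rw [this]
  congr 1

theorem cutNorm_set_bddAbove {f : unitInterval × unitInterval → ℝ} (hf : Integrable f volume) :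
    BddAbove {r : ℝ | ∃ S T : Set unitInterval, NullMeasurableSet S volume ∧
      NullMeasurableSet T volume ∧ r = |∫ p in S ×ˢ T, f p|} := by
  refine ⟨∫ p, |f p|, ?_⟩
  rintro r ⟨S, T, -, -, rfl⟩
  refine (abs_integral_le_integral_abs).trans ?_
  exact setIntegral_le_integral hf.abs (Eventually.of_forall fun p => abs_nonneg _)

theorem cutNorm_le_relabel {f : unitInterval × unitInterval → ℝ} (hf : Integrable f volume)
    (φ : LebesgueAut) : cutNorm f ≤ cutNorm (relabel f φ.1) := by
  refine csSup_le_csSup (cutNorm_set_bddAbove (Integrable.relabel' hf φ))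
    ⟨_, ∅, ∅, MeasurableSet.empty.nullMeasurableSet, MeasurableSet.empty.nullMeasurableSet, rfl⟩ ?_
  rintro r ⟨S, T, hS, hT, rfl⟩
  exact ⟨_, _, (φ.2.1 S hS).1, (φ.2.1 T hT).1, by rw [setIntegral_relabel hf φ hS hT]⟩

theorem cutNorm_relabel {f : unitInterval × unitInterval → ℝ} (hf : Integrable f volume)
    (φ : LebesgueAut) : cutNorm (relabel f φ.1) = cutNorm f := by
  refine le_antisymm ?_ (cutNorm_le_relabel hf φ)
  have h := cutNorm_le_relabel (Integrable.relabel' hf φ) φ.inv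
  have e : relabel (relabel f φ.1) φ.inv.1 = f := by
    funext p
    simp [relabel, LebesgueAut.inv]
  rwa [e] at h

theorem cutNorm_nonneg (f : unitInterval × unitInterval → ℝ) : 0 ≤ cutNorm f := by
  refine Real.sSup_nonneg ?_
  rintro r ⟨S, T, -, -, rfl⟩
  exact abs_nonneg _

theorem cutNorm_neg (f : unitInterval × unitInterval → ℝ) :
    cutNorm (fun p => - f p) = cutNorm f := by
  simp only [cutNorm, integral_neg, abs_neg]

theorem cutNorm_add_le {f g : unitInterval × unitInterval → ℝ} (hf : Integrable f volume)
    (hg : Integrable g volume) : cutNorm (fun p => f p + g p) ≤ cutNorm f + cutNorm g := by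
  refine csSup_le
    ⟨_, ∅, ∅, MeasurableSet.empty.nullMeasurableSet, MeasurableSet.empty.nullMeasurableSet, rfl⟩ ?_
  rintro r ⟨S, T, hS, hT, rfl⟩
  rw [integral_add hf.integrableOn hg.integrableOn]
  refine (abs_add_le _ _).trans (add_le_add ?_ ?_)
  · exact le_csSup (cutNorm_set_bddAbove hf) ⟨S, T, hS, hT, rfl⟩
  · exact le_csSup (cutNorm_set_bddAbove hg) ⟨S, T, hS, hT, rfl⟩

namespace Graphon

theorem cutDist_le (U W : Graphon) (φ : LebesgueAut) :
    cutDist U W ≤ cutNorm (fun p => U p - relabel W φ.1 p) :=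
  ciInf_le ⟨0, by rintro _ ⟨φ, rfl⟩; exact cutNorm_nonneg _⟩ φ

theorem cutDist_nonneg (U W : Graphon) : 0 ≤ cutDist U W :=
  le_ciInf fun _ => cutNorm_nonneg _

theorem cutDist_self (W : Graphon) : cutDist W W = 0 := by
  refine le_antisymm ((cutDist_le W W LebesgueAut.one).trans (le_of_eq ?_)) (cutDist_nonneg W W)
  have e : (fun p => W p - relabel W LebesgueAut.one.1 p) = fun _ => (0 : ℝ) := by
    funext p
    simp [relabel, LebesgueAut.one]
  have s : {r : ℝ | ∃ S T : Set unitInterval, NullMeasurableSet S volume ∧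
      NullMeasurableSet T volume ∧ r = |∫ p in S ×ˢ T, (0 : ℝ)|} = {0} := by
    ext r
    simp only [integral_zero, abs_zero, Set.mem_ofPred_eq, Set.mem_singleton_iff]
    exact ⟨fun ⟨_, _, _, _, h⟩ => h, fun h => ⟨∅, ∅, MeasurableSet.empty.nullMeasurableSet,
      MeasurableSet.empty.nullMeasurableSet, h⟩⟩
  rw [e, cutNorm, s, csSup_singleton]

theorem cutDist_le_symm (U W : Graphon) : cutDist U W ≤ cutDist W U := by
  refine le_ciInf fun φ => (cutDist_le U W φ.inv).trans (le_of_eq ?_)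
  rw [← cutNorm_relabel (f := fun p => U p - relabel W φ.inv.1 p) (U.integrable.sub (Integrable.relabel' W.integrable φ.inv)) φ,
    ← cutNorm_neg]
  congr 1
  funext p
  simp [relabel, LebesgueAut.inv]

theorem cutDist_symm (U W : Graphon) : cutDist U W = cutDist W U :=
  le_antisymm (cutDist_le_symm U W) (cutDist_le_symm W U)

theorem cutDist_triangle (U V W : Graphon) : cutDist U W ≤ cutDist U V + cutDist V W := by
  refine le_ciInf_add_ciInf fun φ ψ => (cutDist_le U W (ψ.comp φ)).trans ?_
  rw [← cutNorm_relabel (f := fun p => V p - relabel W ψ.1 p)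
    (V.integrable.sub (Integrable.relabel' W.integrable ψ)) φ]
  refine le_trans (le_of_eq ?_) (cutNorm_add_le
    (U.integrable.sub (Integrable.relabel' V.integrable φ))
    (Integrable.relabel' (V.integrable.sub (Integrable.relabel' W.integrable ψ)) φ))
  congr 1
  funext p
  simp [relabel, LebesgueAut.comp]

/-- Two graphons are equivalent when their cut distance is `0`. -/
instance setoid : Setoid Graphon where
  r U W := cutDist U W = 0
  iseqv :=
    { refl := cutDist_self
      symm := fun {U W} h => (cutDist_symm W U).trans h
      trans := fun {U V W} h₁ h₂ => le_antisymm
        ((cutDist_triangle U V W).trans (by rw [h₁, h₂, add_zero])) (cutDist_nonneg U W) }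

/-- The equivalence class `[W]`. -/
def cls (W : Graphon) : Quotient setoid := Quotient.mk setoid W

end Graphon

/-! ### Graph limits -/

/-- A graph limit: a class `[W]` that has a representative with values in `[0,1]`. -/
abbrev GraphLimit : Type := {x : Quotient Graphon.setoid // ∃ W : Graphon, W.IsUnitValued ∧ W.cls = x}

/-- The metric induced by the cut distance on classes of graphons. -/
def clsCutDist (x y : Quotient Graphon.setoid) : ℝ :=
  Quotient.lift₂ Graphon.cutDist (by
    intro U W U' W' hU hW
    have hU : Graphon.cutDist U U' = 0 := hU
    have hW : Graphon.cutDist W W' = 0 := hW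
    have a := Graphon.cutDist_triangle U U' W
    have b := Graphon.cutDist_triangle U' W' W
    have c := Graphon.cutDist_triangle U' U W'
    have d := Graphon.cutDist_triangle U W W'
    rw [Graphon.cutDist_symm W' W] at b
    rw [Graphon.cutDist_symm U' U] at c
    linarith) x y

/-- The cut distance of two graph limits. -/
def GraphLimit.cutDist (x y : GraphLimit) : ℝ := clsCutDist x.1 y.1

/-! ### The graphon of a graph -/

/-- The half-open interval `[k/n, (k+1)/n)` inside `[0,1]`. -/
def gridInterval (n : ℕ) (k : Fin n) : Set unitInterval :=
  {x | (k : ℝ) / n ≤ (x : ℝ) ∧ (x : ℝ) < ((k : ℝ) + 1) / n}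

/-- The set on which the graphon of `G` is `1`: the union of the squares of the adjacent pairs. -/
def edgeRegion {n : ℕ} (G : SimpleGraph (Fin n)) : Set (unitInterval × unitInterval) :=
  {p | ∃ k l : Fin n, G.Adj k l ∧ p.1 ∈ gridInterval n k ∧ p.2 ∈ gridInterval n l}

theorem measurableSet_edgeRegion {n : ℕ} (G : SimpleGraph (Fin n)) :
    MeasurableSet (edgeRegion G) := by
  have hI : ∀ k, MeasurableSet (gridInterval n k) := fun k =>
    (measurableSet_le measurable_const measurable_subtype_coe).inter
      (measurableSet_lt measurable_subtype_coe measurable_const)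
  have e : edgeRegion G =
      ⋃ (k : Fin n) (l : Fin n) (_ : G.Adj k l), gridInterval n k ×ˢ gridInterval n l := by
    ext p
    simp only [edgeRegion, Set.mem_ofPred_eq, Set.mem_iUnion, Set.mem_prod, exists_prop]
  rw [e]
  exact MeasurableSet.iUnion fun k => MeasurableSet.iUnion fun l => MeasurableSet.iUnion fun _ =>
    (hI k).prod (hI l)

/-- The graphon `W_G` of a graph `G` with `n` vertices. -/
def graphonOfGraph {n : ℕ} (G : SimpleGraph (Fin n)) : Graphon where
  toFun := (edgeRegion G).indicator 1
  symm' x y := by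
    have h : (x, y) ∈ edgeRegion G ↔ (y, x) ∈ edgeRegion G :=
      ⟨fun ⟨k, l, a, b, c⟩ => ⟨l, k, a.symm, c, b⟩, fun ⟨k, l, a, b, c⟩ => ⟨l, k, a.symm, c, b⟩⟩
    by_cases hx : (x, y) ∈ edgeRegion G
    · simp [hx, h.1 hx]
    · simp [hx, mt h.2 hx]
  bounded' := ⟨1, fun p => by by_cases hp : p ∈ edgeRegion G <;> simp [hp]⟩
  measurable' := (measurable_one.indicator (measurableSet_edgeRegion G)).nullMeasurable

/-- The graph limit `[W_G]` of a graph `G`. -/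
def graphLimitOfGraph {n : ℕ} (G : SimpleGraph (Fin n)) : GraphLimit :=
  ⟨(graphonOfGraph G).cls, graphonOfGraph G, fun p => by
    by_cases hp : p ∈ edgeRegion G <;> simp [graphonOfGraph, hp], rfl⟩

end

/-! ### Relabelling by a measure preserving bijection -/

/-! The cut norm only controls integrals over rectangles, but for a uniformly bounded sequence a π-λ
argument upgrades this to every fixed measurable set (`tendsto_setIntegral_of_cutNorm`). If `0 ≤ f n
≤ 1` and `w` is `{0,1}`-valued, then `f n - w` has constant sign on `{w = 1}` and on its complement,
so its `ℓ₁`-norm is a signed sum of two such integrals and tends to `0`. This gives one direction.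

For the other, `min |W| |W - 1|` is the pointwise distance from `W` to `{0,1}`. Its integral is
invariant under relabelling and bounds from below `δ₁` of `W` to any `{0,1}`-valued graphon; if
these distances tend to `0`, the integral vanishes.

Both arguments, applied to constant sequences, show that any representative of `[W_G]` is itself
`{0,1}`-valued almost everywhere. -/

theorem ae_relabel {f : unitInterval × unitInterval → ℝ} {P : ℝ → Prop} (hf : ∀ᵐ p, P (f p))
    (φ : LebesgueAut) : ∀ᵐ p, P (relabel f φ.1 p) := by
  obtain ⟨h1, h2⟩ := φ.2.1.prod
  rw [← h2] at hf
  exact ae_of_ae_map h1 hf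

theorem integral_relabel {f : unitInterval × unitInterval → ℝ} (hf : Integrable f volume)
    (φ : LebesgueAut) : ∫ p, relabel f φ.1 p = ∫ p, f p := by
  have := setIntegral_relabel hf φ (S := Set.univ) (T := Set.univ)
    MeasurableSet.univ.nullMeasurableSet MeasurableSet.univ.nullMeasurableSet
  simpa using this.symm

theorem ellOneNorm_relabel {f : unitInterval × unitInterval → ℝ} (hf : Integrable f volume)
    (φ : LebesgueAut) : ellOneNorm (relabel f φ.1) = ellOneNorm f :=
  integral_relabel hf.abs φ

/-! ### Weak convergence from convergence in the cut norm -/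

theorem abs_setIntegral_prod_le_cutNorm {f : unitInterval × unitInterval → ℝ}
    (hf : Integrable f volume) {S T : Set unitInterval} (hS : MeasurableSet S)
    (hT : MeasurableSet T) : |∫ p in S ×ˢ T, f p| ≤ cutNorm f :=
  le_csSup (cutNorm_set_bddAbove hf) ⟨S, T, hS.nullMeasurableSet, hT.nullMeasurableSet, rfl⟩

/-- A uniformly bounded sequence that tends to `0` in the cut norm tends to `0` in mean on every
measurable set. -/
theorem tendsto_setIntegral_of_cutNorm {f : ℕ → unitInterval × unitInterval → ℝ}
    (hf : ∀ n, Integrable (f n) volume) {C : ℝ} (hC : ∀ n, ∀ᵐ p, |f n p| ≤ C)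
    (h : Tendsto (fun n => cutNorm (f n)) atTop (𝓝 0))
    {A : Set (unitInterval × unitInterval)} (hA : MeasurableSet A) :
    Tendsto (fun n => ∫ p in A, f n p) atTop (𝓝 0) := by
  have hrect : ∀ S T : Set unitInterval, MeasurableSet S → MeasurableSet T →
      Tendsto (fun n => ∫ p in S ×ˢ T, f n p) atTop (𝓝 0) := fun S T hS hT =>
    squeeze_zero_norm (fun n => abs_setIntegral_prod_le_cutNorm (hf n) hS hT) h
  induction A, hA using MeasurableSpace.induction_on_inter generateFrom_prod.symm isPiSystem_prod with
  | empty => simp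
  | basic t ht =>
    obtain ⟨S, hS, T, hT, rfl⟩ := ht
    exact hrect S T hS hT
  | compl t ht ih =>
    have huniv := hrect Set.univ Set.univ MeasurableSet.univ MeasurableSet.univ
    simp only [Set.univ_prod_univ, setIntegral_univ] at huniv
    have e : ∀ n, ∫ p in tᶜ, f n p = (∫ p, f n p) - ∫ p in t, f n p := fun n => by
      rw [← integral_add_compl ht (hf n)]
      ring
    simp only [e]
    simpa using huniv.sub ih
  | iUnion t hd hm ih =>
    have e : ∀ n, ∫ p in ⋃ i, t i, f n p = ∑' i, ∫ p in t i, f n p := fun n =>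
      integral_iUnion hm hd (hf n).integrableOn
    simp only [e]
    -- The uniform bound gives a summable majorant independent of `n`, which permits exchanging the
    -- limit with the sum over the pieces.
    have hs : Summable fun i => C * volume.real (t i) := by
      refine Summable.mul_left C (ENNReal.summable_toReal ?_)
      rw [← measure_iUnion hd hm]
      exact measure_ne_top _ _
    have := tendsto_tsum_of_dominated_convergence (𝓕 := atTop) (g := fun _ => (0 : ℝ)) hs ih
      (Eventually.of_forall fun n i => norm_setIntegral_le_of_norm_le_const_ae
        (measure_lt_top _ _) (by
          filter_upwards [ae_restrict_of_ae (hC n)] with p hp using hp))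
    simpa using this

/-- If functions with values in `[0,1]` tend to a `{0,1}`-valued function in the cut norm, then
they tend to it in the `ℓ₁`-norm. -/
theorem tendsto_ellOneNorm_of_cutNorm {f : ℕ → unitInterval × unitInterval → ℝ}
    (hf : ∀ n, Integrable (f n) volume) (h01 : ∀ n, ∀ᵐ p, 0 ≤ f n p ∧ f n p ≤ 1)
    {w : unitInterval × unitInterval → ℝ} (hw : Integrable w volume)
    (hw01 : ∀ᵐ p, w p = 0 ∨ w p = 1)
    (h : Tendsto (fun n => cutNorm (fun p => f n p - w p)) atTop (𝓝 0)) :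
    Tendsto (fun n => ellOneNorm (fun p => f n p - w p)) atTop (𝓝 0) := by
  -- `w` is only almost everywhere measurable; a measurable version makes the level set a measurable
  -- set.
  obtain ⟨g, hg, hwg⟩ := hw.1.aemeasurable
  have hA : MeasurableSet {p | g p = 1} := hg (measurableSet_singleton 1)
  have hint : ∀ n, Integrable (fun p => f n p - w p) volume := fun n => (hf n).sub hw
  have hC : ∀ n, ∀ᵐ p, |f n p - w p| ≤ 1 := fun n => by
    filter_upwards [h01 n, hw01] with p hp hq
    rw [abs_le]
    rcases hq with hq | hq <;> rw [hq] <;> constructor <;> linarith [hp.1, hp.2]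
  have lim1 := tendsto_setIntegral_of_cutNorm hint hC h hA
  have lim2 := tendsto_setIntegral_of_cutNorm hint hC h hA.compl
  have e : ∀ n, ellOneNorm (fun p => f n p - w p) =
      -(∫ p in {p | g p = 1}, (f n p - w p)) + ∫ p in {p | g p = 1}ᶜ, (f n p - w p) := fun n => by
    rw [ellOneNorm, ← integral_add_compl hA (hint n).abs, ← integral_neg]
    congr 1
    · refine setIntegral_congr_ae hA ?_
      filter_upwards [h01 n, hwg] with p hp hq hpA
      have : w p = 1 := hq.trans hpA
      rw [this, abs_of_nonpos (by linarith [hp.2])]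
    · refine setIntegral_congr_ae hA.compl ?_
      filter_upwards [h01 n, hwg, hw01] with p hp hq hr hpA
      have : w p = 0 := hr.resolve_right fun h1 => hpA (hq.symm.trans h1)
      rw [this, abs_of_nonneg (by linarith [hp.1])]
  simp only [e]
  simpa using lim1.neg.add lim2

namespace Graphon

/-! ### Graphons at cut distance tending to zero -/

theorem integrable_sub_relabel (U W : Graphon) (φ : LebesgueAut) :
    Integrable (fun p => U p - relabel W φ.1 p) volume :=
  U.integrable.sub (Integrable.relabel' W.integrable φ)

/-- The infimum in the cut distance need not be attained, so relabellings are chosen with slack `1 /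
(n + 1)`. -/
theorem exists_tendsto_cutNorm {U W : ℕ → Graphon}
    (h : Tendsto (fun n => (U n).cutDist (W n)) atTop (𝓝 0)) :
    ∃ φ : ℕ → LebesgueAut,
      Tendsto (fun n => cutNorm (fun p => U n p - relabel (W n) (φ n).1 p)) atTop (𝓝 0) := by
  have hex : ∀ n : ℕ, ∃ φ : LebesgueAut, cutNorm (fun p => U n p - relabel (W n) φ.1 p) <
      (U n).cutDist (W n) + 1 / ((n : ℝ) + 1) := fun n =>
    exists_lt_of_ciInf_lt (lt_add_of_pos_right _ (by positivity))
  choose φ hφ using hex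
  refine ⟨φ, squeeze_zero (fun n => cutNorm_nonneg _) (fun n => (hφ n).le) ?_⟩
  simpa using h.add tendsto_one_div_add_atTop_nhds_zero_nat

theorem delta1_nonneg (U W : Graphon) : 0 ≤ U.delta1 W :=
  le_ciInf fun _ => integral_nonneg fun _ => abs_nonneg _

theorem delta1_le (U W : Graphon) (φ : LebesgueAut) :
    U.delta1 W ≤ ellOneNorm (fun p => U p - relabel W φ.1 p) :=
  ciInf_le ⟨0, by rintro _ ⟨φ, rfl⟩; exact integral_nonneg fun _ => abs_nonneg _⟩ φ

/-- Convergence in the cut distance to a `{0,1}`-valued graphon implies convergence in `δ₁`. -/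
theorem tendsto_delta1_of_cutDist {U : ℕ → Graphon} (hU : ∀ n, ∀ᵐ p, 0 ≤ U n p ∧ U n p ≤ 1)
    {W : Graphon} (hW : ∀ᵐ p, W p = 0 ∨ W p = 1)
    (h : Tendsto (fun n => (U n).cutDist W) atTop (𝓝 0)) :
    Tendsto (fun n => (U n).delta1 W) atTop (𝓝 0) := by
  obtain ⟨φ, hφ⟩ := exists_tendsto_cutNorm (W := fun _ => W) h
  -- The relabelling is moved from `W` to `U n`: the limit function, and hence the sets to integrate
  -- over, must not vary with `n`.
  have e : ∀ n, relabel (fun p => U n p - relabel W (φ n).1 p) (φ n).inv.1 =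
      fun p => relabel (U n) (φ n).inv.1 p - W p := fun n => by
    funext p
    simp [relabel, LebesgueAut.inv]
  have hcut : Tendsto (fun n => cutNorm (fun p => relabel (U n) (φ n).inv.1 p - W p))
      atTop (𝓝 0) := by
    refine hφ.congr fun n => ?_
    rw [← e, cutNorm_relabel (integrable_sub_relabel _ _ _)]
  refine squeeze_zero (fun n => delta1_nonneg _ _) (fun n => delta1_le _ _ (φ n))
    ((tendsto_ellOneNorm_of_cutNorm (fun n => Integrable.relabel' (U n).integrable (φ n).inv)
      (fun n => ae_relabel (P := fun t => 0 ≤ t ∧ t ≤ 1) (hU n) (φ n).inv)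
      W.integrable hW hcut).congr fun n => ?_)
  rw [← e, ellOneNorm_relabel (integrable_sub_relabel _ _ _)]

/-- Up to null sets, the property of having values in `[0,1]` depends on the class only. -/
theorem IsUnitValued.ae_of_cutDist_eq_zero {U V : Graphon} (hV : V.IsUnitValued)
    (h : U.cutDist V = 0) : ∀ᵐ p, 0 ≤ U p ∧ U p ≤ 1 := by
  obtain ⟨φ, hφ⟩ := exists_tendsto_cutNorm (U := fun _ => U) (W := fun _ => V)
    (by simp [h])
  obtain ⟨C, hC⟩ := U.bounded'
  have hrel : ∀ n p, 0 ≤ relabel V (φ n).1 p ∧ relabel V (φ n).1 p ≤ 1 := fun n p => hV _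
  have key : ∀ A : Set (unitInterval × unitInterval), MeasurableSet A →
      Tendsto (fun n => ∫ p in A, (U p - relabel V (φ n).1 p)) atTop (𝓝 0) := fun A hA =>
    tendsto_setIntegral_of_cutNorm (fun n => integrable_sub_relabel _ _ _) (C := C + 1)
      (fun n => Eventually.of_forall fun p => by
        have h1 := abs_le.1 (hC p)
        have h2 := hrel n p
        exact abs_le.2 ⟨by linarith, by linarith⟩) hφ hA
  have h0 : 0 ≤ᵐ[volume] (U : unitInterval × unitInterval → ℝ) := by
    refine ae_nonneg_of_forall_setIntegral_nonneg U.integrable fun A hA _ => ?_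
    -- As `V ≥ 0`, the integral of `U` over `A` dominates that of `U - V^φ`, which tends to `0`. The
    -- upper bound below is symmetric: `1 - U ≥ V^φ - U`.
    refine le_of_tendsto (key A hA) (Eventually.of_forall fun n => ?_)
    exact integral_mono (integrable_sub_relabel _ _ _).integrableOn U.integrable.integrableOn
      fun p => by linarith [(hrel n p).1]
  have h1 : 0 ≤ᵐ[volume] fun p => 1 - U p := by
    have hi : Integrable (fun p => 1 - U p) volume := (integrable_const 1).sub U.integrable
    refine ae_nonneg_of_forall_setIntegral_nonneg hi fun A hA _ => ?_
    have := (key A hA).neg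
    rw [neg_zero] at this
    refine le_of_tendsto this (Eventually.of_forall fun n => ?_)
    rw [← integral_neg]
    exact integral_mono (integrable_sub_relabel _ _ _).neg.integrableOn hi.integrableOn
      fun p => by simpa using (hrel n p).2
  filter_upwards [h0, h1] with p hp hq
  exact ⟨hp, sub_nonneg.1 hq⟩

/-! ### The distance to the `{0,1}`-valued functions -/

theorem integrable_min_abs (W : Graphon) :
    Integrable (fun p => min |W p| |W p - 1|) volume :=
  W.integrable.abs.inf (W.integrable.sub (integrable_const 1)).abs

/-- Pointwise, `|U - W^φ|` is one of `|W^φ|` and `|W^φ - 1|`, and the integral of their minimum does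
not depend on `φ`. -/
theorem integral_min_abs_le_delta1 {U : Graphon} (hU : ∀ᵐ p, U p = 0 ∨ U p = 1) (W : Graphon) :
    ∫ p, min |W p| |W p - 1| ≤ U.delta1 W := by
  refine le_ciInf fun φ => ?_
  rw [← integral_relabel W.integrable_min_abs φ]
  refine integral_mono_ae (Integrable.relabel' W.integrable_min_abs φ)
    (integrable_sub_relabel _ _ _).abs ?_
  filter_upwards [hU] with p hp
  rcases hp with hp | hp
  · simp [hp, relabel]
  · simp [hp, relabel, abs_sub_comm (1 : ℝ)]

theorem ae_eq_zero_or_one_of_tendsto_delta1 {U : ℕ → Graphon}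
    (hU : ∀ n, ∀ᵐ p, U n p = 0 ∨ U n p = 1) {W : Graphon}
    (h : Tendsto (fun n => (U n).delta1 W) atTop (𝓝 0)) : ∀ᵐ p, W p = 0 ∨ W p = 1 := by
  have hnn : ∀ p, 0 ≤ min |W p| |W p - 1| := fun p => le_min (abs_nonneg _) (abs_nonneg _)
  have hle : ∫ p, min |W p| |W p - 1| ≤ 0 :=
    ge_of_tendsto h (Eventually.of_forall fun n => integral_min_abs_le_delta1 (hU n) W)
  have hz := (integral_eq_zero_iff_of_nonneg hnn W.integrable_min_abs).1
    (hle.antisymm (integral_nonneg hnn))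
  filter_upwards [hz] with p hp
  rcases min_choice |W p| |W p - 1| with hm | hm
  · exact Or.inl (abs_eq_zero.1 (hm.symm.trans hp))
  · exact Or.inr (sub_eq_zero.1 (abs_eq_zero.1 (hm.symm.trans hp)))

/-- Up to null sets, the property of having values in `{0,1}` depends on the class only. -/
theorem ae_eq_zero_or_one_of_cutDist_eq_zero {U V : Graphon} (hV : ∀ p, V p = 0 ∨ V p = 1)
    (h : U.cutDist V = 0) : ∀ᵐ p, U p = 0 ∨ U p = 1 := by
  have hV01 : V.IsUnitValued := fun p => by rcases hV p with hp | hp <;> simp [hp]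
  have hU := hV01.ae_of_cutDist_eq_zero h
  have hlim := tendsto_delta1_of_cutDist (U := fun _ => U) (fun _ => hU)
    (Eventually.of_forall hV) (by simp [h])
  -- A constant sequence that tends to `0` is `0`, so `δ₁(U, V) = 0`.
  have hVV := tendsto_nhds_unique tendsto_const_nhds hlim
  obtain ⟨C, hC⟩ := U.bounded'
  -- The criterion wants the graphon known to be `{0,1}`-valued as first argument, so `δ₁` is
  -- reversed by passing to inverse relabellings.
  have hsymm : V.delta1 U ≤ U.delta1 V := by
    refine le_ciInf fun φ => (delta1_le V U φ.inv).trans (le_of_eq ?_)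
    rw [← ellOneNorm_relabel (integrable_sub_relabel V U φ.inv) φ]
    refine integral_congr_ae (Eventually.of_forall fun p => ?_)
    simp [relabel, LebesgueAut.inv, abs_sub_comm]
  refine ae_eq_zero_or_one_of_tendsto_delta1 (U := fun _ => V)
    (fun _ => Eventually.of_forall hV) ?_
  rw [le_antisymm (hsymm.trans hVV.le) (delta1_nonneg V U)]
  exact tendsto_const_nhds

theorem cutDist_eq_zero_of_cls_eq {U W : Graphon} (h : U.cls = W.cls) : U.cutDist W = 0 :=
  Quotient.exact h

end Graphon

theorem graphonOfGraph_eq_zero_or_one {n : ℕ} (G : SimpleGraph (Fin n))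
    (p : unitInterval × unitInterval) : graphonOfGraph G p = 0 ∨ graphonOfGraph G p = 1 := by
  by_cases hp : p ∈ edgeRegion G <;> simp [graphonOfGraph, hp]

theorem mainTheorem5
    (v : ℕ → ℕ) (G : ∀ n, SimpleGraph (Fin (v n)))
    (x : GraphLimit)
    (hG : Tendsto (fun n => (graphLimitOfGraph (G n)).cutDist x) atTop (𝓝 0))
    (U : ℕ → Graphon) (hU : ∀ n, (U n).cls = (graphLimitOfGraph (G n)).1)
    (W : Graphon) (hW : W.cls = x.1) :
    Tendsto (fun n => (U n).delta1 W) atTop (𝓝 0) ↔ ∀ᵐ p, W p = 0 ∨ W p = 1 := by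
  have hU01 : ∀ n, ∀ᵐ p, U n p = 0 ∨ U n p = 1 := fun n =>
    Graphon.ae_eq_zero_or_one_of_cutDist_eq_zero (graphonOfGraph_eq_zero_or_one (G n))
      (Graphon.cutDist_eq_zero_of_cls_eq (hU n))
  refine ⟨Graphon.ae_eq_zero_or_one_of_tendsto_delta1 hU01, fun hW01 => ?_⟩
  refine Graphon.tendsto_delta1_of_cutDist (fun n => ?_) hW01 (hG.congr fun n => ?_)
  · filter_upwards [hU01 n] with p hp
    rcases hp with hp | hp <;> simp [hp]
  -- The distance of classes is a quotient lift, so on the chosen representatives it unfolds to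
  -- their `cutDist`.
  · rw [GraphLimit.cutDist, ← hU n, ← hW]
    rfl
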